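/- **Notation.** For a finite-valued convex function $J:\mathbb R^N\to\mathbb R$ and $x\in\mathbb R^N$ let $\bar S_x=\mathrm{Aff}\,\partial J(x)$ be the affine hull of the subdifferential, $e_x$ the orthogonal projection of $0$ onto $\bar S_x$, $S_x=\bar S_x-e_x$ and $T_x=S_x^\perp$ (the model subspace); a superscript ($T^J_x$, $e^J_x$, ...) shows the function. A gauge is a function $\gamma_C(v)=\inf\{\lambda>0: v\in\lambda C\}\in[0,+\infty]$ (with $\inf\emptyset=+\infty$), where $C\subseteq\mathbb R^N$ is closed, convex and contains $0$. For $f\in\mathrm{ri}\,\partial J(x)$ the subdifferential gauge is $J^{x,\circ}_{f}=\gamma_{\partial J(x)-f}$. For a linear map $A:V_1\to V_2$ between subspaces and gauges $\Gamma_1,\Gamma_2$ finite on $V_1,V_2$, put $\|A\|_{\Gamma_1\to\Gamma_2}=\sup\{\Gamma_2(Av): v\in V_1,\ \Gamma_1(v)\le 1\}$. $P_V$ is the orthogonal projector onto $V$. $J$ is *partly smooth at $x$ relative to a set $M$* if: $M$ is a $C^2$-manifold around $x\in M$ and $J|_M$ is $C^2$ around $x$; the tangent space of $M$ at $x$ is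 $T_x$; and the set-valued map $\partial J$ is continuous at $x$ relative to $M$. Write $J\in \mathrm{PSFL}_x(\Gamma,f,\nu,\mu,\tau,\xi)$, where $\nu\in[0,+\infty]$ and $\mu,\tau,\xi\in[0,+\infty)$, if, with $T=T_x$ and $S=S_x$: * $J$ is finite-valued, convex and partly smooth at $x$ relative to $T$, and $\partial J$ is Lipschitz around $x$ relative to $T$ (for some $K$, $\partial J(y)\subseteq\partial J(z)+K\|y-z\|\mathbb B$, with $\mathbb B$ the closed Euclidean unit ball, for all $y,z\in T$ near $x$); * $\Gamma$ is a gauge that is finite and coercive on $T$; * $y\in T\mapsto f_y\in\mathrm{ri}\,\partial J(y)$ is a map that is Lipschitz around $x$ (relative to $T$); * for all $x'\in T$ with $\Gamma(x-x')\le\nu$ one has $T_x=T_{x'}$; and for all $x'\in T$ with $\Gamma(x-x')<\nu$, $$\Gamma(e_x-e_{x'})\le\mu\,\Gamma(x-x'),\qquad J^{x,\circ}_{f_x}(P_S(f_x-f_{x'}))\le\tau\,\Gamma(x-x'),\qquad \sup_{u\in S,\,u\ne0}\frac{J^{x',\circ}_{f_{x'}}(u)-J^{x,\circ}_{f_x}(u)}{J^{x,\circ}_{f_x}(u)}\le\xi\,\Gamma(x-x')$$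 (the last condition being void if $S=\{0\}$). **Proposition.** Let $x\in\mathbb R^N$ and suppose that $$J\in \mathrm{PSFL}_x(\Gamma^J,f^J,\nu^J_x,\mu^J_x,\tau^J_x,\xi^J_x)\quad\text{and}\quad G\in \mathrm{PSFL}_x(\Gamma^G,f^G,\nu^G_x,\mu^G_x,\tau^G_x,\xi^G_x).$$ Let $H=J+G$, $f^H=f^J+f^G$, $\Gamma^H=\max(\Gamma^J,\Gamma^G)$, and write $T^J,T^G,T^H,S^H$ for $T^J_x,T^G_x,T^H_x,S^H_x$. Then $$H\in \mathrm{PSFL}_x(\Gamma^H,f^H,\nu^H_x,\mu^H_x,\tau^H_x,\xi^H_x)$$ with \begin{align*} \nu^H_x&=\min(\nu^J_x,\nu^G_x),\\ \mu^H_x&=\mu^J_x\,\|P_{T^H}\|_{\Gamma^J\to\Gamma^H}+\mu^G_x\,\|P_{T^H}\|_{\Gamma^G\to\Gamma^H},\\ \tau^H_x&=\tau^J_x+\tau^G_x+\mu^J_x\,\|P_{S^H\cap T^J}\|_{\Gamma^J\to H^{x,\circ}_{f^H_x}}+\mu^G_x\,\|P_{S^H\cap T^G}\|_{\Gamma^G\to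 H^{x,\circ}_{f^H_x}},\\ \xi^H_x&=\max(\xi^J_x,\xi^G_x), \end{align*} where the projectors are regarded as maps defined on $T^J$ (where $\Gamma^J$ is taken) resp. on $T^G$ (where $\Gamma^G$ is taken), and the four operator bounds are finite. -/

import Mathlib

open Set Filter Topology
open scoped ENNReal NNReal Pointwise

namespace PartlySmooth

noncomputable section

section Objects

variable {E : Type*} [NormedAddCommGroup E] [InnerProductSpace ℝ E]

/-- The subdifferential `∂J(x)` of a finite-valued function `J`. -/
def subdiff (J : E → ℝ) (x : E) : Set E :=
  {u | ∀ y : E, J x + inner ℝ u (y - x) ≤ J y}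

/-- The affine hull `S̄_x` of the subdifferential at `x`. -/
def affHull (J : E → ℝ) (x : E) : AffineSubspace ℝ E :=
  affineSpan ℝ (subdiff J x)

/-- The subspace `S_x = S̄_x - e_x`, i.e. the linear subspace parallel to the affine hull of the
subdifferential. -/
def normalSubspace (J : E → ℝ) (x : E) : Submodule ℝ E :=
  (affHull J x).direction

/-- The model subspace `T_x`, the orthogonal complement of `S_x`. -/
def modelSubspace (J : E → ℝ) (x : E) : Submodule ℝ E :=
  (normalSubspace J x)ᗮ

open Classical in
/-- The vector `e_x`: the orthogonal projection of `0` onto the affine hull of the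
subdifferential. (For a finite-valued convex function on a Euclidean space the subdifferential is
never empty, so that the default value `0` is not used.) -/
def modelVector [FiniteDimensional ℝ E] (J : E → ℝ) (x : E) : E :=
  if h : Nonempty (affHull J x) then
    haveI := h
    (EuclideanGeometry.orthogonalProjection (affHull J x) (0 : E) : E)
  else 0

/-- The gauge `γ_C(v) = inf {r > 0 : v ∈ r C}`, with value `+∞` if there is no such `r`. -/
def extGauge (C : Set E) (v : E) : ℝ≥0∞ :=
  ⨅ (r : ℝ) (_ : 0 < r ∧ v ∈ r • C), ENNReal.ofReal r

/-- `Γ` is a gauge: the gauge function of a closed convex set that contains the origin. -/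
def IsGauge (Γ : E → ℝ≥0∞) : Prop :=
  ∃ C : Set E, IsClosed C ∧ Convex ℝ C ∧ (0 : E) ∈ C ∧ Γ = extGauge C

/-- `Γ` is finite on the subspace `V`. -/
def FiniteOn (Γ : E → ℝ≥0∞) (V : Submodule ℝ E) : Prop :=
  ∀ v ∈ V, Γ v ≠ ⊤

/-- `Γ` is coercive on the subspace `V`: `Γ(v) → +∞` as `‖v‖ → +∞`, `v ∈ V`. -/
def CoerciveOn (Γ : E → ℝ≥0∞) (V : Submodule ℝ E) : Prop :=
  Tendsto Γ (Bornology.cobounded E ⊓ 𝓟 (V : Set E)) (𝓝 ⊤)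

/-- The subdifferential gauge: the gauge of `∂J(x) - f`. -/
def subdiffGauge (J : E → ℝ) (f : E) (x : E) : E → ℝ≥0∞ :=
  extGauge {v | f + v ∈ subdiff J x}

/-- The operator bound between the gauge `Γ₁`, considered on the subspace `V`, and `Γ₂`, of a map
`A` defined on `V`: the supremum of `Γ₂(A v)` over the `v ∈ V` with `Γ₁(v) ≤ 1`. -/
def opBound (V : Submodule ℝ E) (A : E → E) (Γ₁ Γ₂ : E → ℝ≥0∞) : ℝ≥0∞ :=
  ⨆ (v : E) (_ : v ∈ V ∧ Γ₁ v ≤ 1), Γ₂ (A v)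

/-- The set `M` is a `C²` submanifold around its point `x`, with tangent space `T` at `x`: near
`x` it is the zero set of a `C²` map whose derivative at `x` is onto, with kernel `T`. -/
def IsC2ManifoldAt (M : Set E) (x : E) (T : Submodule ℝ E) : Prop :=
  x ∈ M ∧ ∃ (k : ℕ) (Φ : E → EuclideanSpace ℝ (Fin k)),
    ContDiffAt ℝ 2 Φ x ∧
    Function.Surjective (fderiv ℝ Φ x) ∧
    (∀ v : E, v ∈ T ↔ fderiv ℝ Φ x v = 0) ∧
    ∀ᶠ y in 𝓝 x, (y ∈ M ↔ Φ y = 0)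

/-- The restriction of `J` to `M` is `C²` around `x`: near `x` it coincides on `M` with a function
that is `C²` on a neighbourhood of `x` in the ambient space. -/
def IsC2OnAround (J : E → ℝ) (M : Set E) (x : E) : Prop :=
  ∃ J' : E → ℝ, ContDiffAt ℝ 2 J' x ∧ ∀ᶠ y in 𝓝[M] x, J' y = J y

/-- The finite-valued convex function `J` is partly smooth at `x` relative to the set `M`. -/
structure IsPartlySmoothAt (J : E → ℝ) (M : Set E) (x : E) : Prop where
  convex : ConvexOn ℝ univ J
  /-- `J` restricted to `M` is `C²` around `x`. -/
  smooth : IsC2OnAround J M x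
  /-- `M` is a `C²`-manifold around `x` whose tangent space at `x` is the model subspace. -/
  sharp : IsC2ManifoldAt M x (modelSubspace J x)
  /-- The set-valued map `∂J` is continuous at `x` relative to `M`. -/
  continuous_upper : UpperHemicontinuousWithinAt (subdiff J) M x
  continuous_lower : LowerHemicontinuousWithinAt (subdiff J) M x

/-- The set-valued map `F` is Lipschitz-continuous around `x` relative to `M`: for some `K`,
`F y ⊆ F z + K ‖y - z‖ 𝔹` for all `y, z ∈ M` near `x`. -/
def SetLipschitzAround (F : E → Set E) (M : Set E) (x : E) : Prop :=
  ∃ K : ℝ≥0, ∃ U ∈ 𝓝 x, ∀ y ∈ U ∩ M, ∀ z ∈ U ∩ M,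
    ∀ u ∈ F y, ∃ v ∈ F z, ‖u - v‖ ≤ K * ‖y - z‖

/-- The map `f` is Lipschitz-continuous around `x` relative to `M`. -/
def LipschitzAround (f : E → E) (M : Set E) (x : E) : Prop :=
  ∃ K : ℝ≥0, ∃ U ∈ 𝓝 x, LipschitzOnWith K f (U ∩ M)

/-- `J` belongs to `PSFL_x(Γ, f, ν, μ, τ, ξ)`: the finite-valued convex function `J` is partly
smooth at `x` relative to its model subspace `T = T_x`, its subdifferential is Lipschitz around `x`
relative to `T`, and `(Γ, f, ν, μ, τ, ξ)` are parameters for `J` at `x`. Only the values of `f` on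
`T` matter. -/
structure PSFL [FiniteDimensional ℝ E] (x : E) (Γ : E → ℝ≥0∞) (f : E → E) (ν μ τ ξ : ℝ≥0∞)
    (J : E → ℝ) : Prop where
  partlySmooth : IsPartlySmoothAt J (modelSubspace J x) x
  subdiff_lipschitz : SetLipschitzAround (subdiff J) (modelSubspace J x) x
  isGauge : IsGauge Γ
  gauge_finite : FiniteOn Γ (modelSubspace J x)
  gauge_coercive : CoerciveOn Γ (modelSubspace J x)
  /-- `f` is a selection of the relative interior of the subdifferential on `T`. -/
  selection : ∀ y ∈ modelSubspace J x, f y ∈ intrinsicInterior ℝ (subdiff J y)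
  selection_lipschitz : LipschitzAround f (modelSubspace J x) x
  /-- `μ`, `τ`, `ξ` are non-negative reals (`ν = +∞` is allowed). -/
  mu_ne_top : μ ≠ ⊤
  tau_ne_top : τ ≠ ⊤
  xi_ne_top : ξ ≠ ⊤
  nu_stable : ∀ x' ∈ modelSubspace J x, Γ (x - x') ≤ ν →
    modelSubspace J x = modelSubspace J x'
  mu_stable : ∀ x' ∈ modelSubspace J x, Γ (x - x') < ν →
    Γ (modelVector J x - modelVector J x') ≤ μ * Γ (x - x')
  tau_stable : ∀ x' ∈ modelSubspace J x, Γ (x - x') < ν →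
    subdiffGauge J (f x) x ((normalSubspace J x).starProjection (f x - f x'))
      ≤ τ * Γ (x - x')
  /-- The subtraction is truncated at `0`, which is harmless since the right side is `≥ 0`; for
  these `u` the denominator is positive and finite. -/
  xi_stable : ∀ x' ∈ modelSubspace J x, Γ (x - x') < ν →
    ⨆ (u : E) (_ : u ∈ normalSubspace J x ∧ u ≠ 0),
      (subdiffGauge J (f x') x' u - subdiffGauge J (f x) x u) / subdiffGauge J (f x) x u
      ≤ ξ * Γ (x - x')

end Objects

end

end PartlySmooth

open PartlySmooth

/-! Everything rests on the Moreau–Rockafellar rule `∂H = ∂J + ∂G` (`subdiff_add`, by separating an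
epigraph from a hypograph). It yields `S^H = S^J + S^G`, `T^H = T^J ∩ T^G` and `e^H = P_{T^H}(e^J +
e^G)`; relative interiors add as well, and the gauge of `∂H - f^H` is that of `(∂J - f^J) + (∂G -
f^G)`.

Lipschitz continuity of the subdifferential passes to Minkowski sums and, with compactness of
`∂H(x)`, gives the continuity required by partial smoothness.

For `μ`, the differences of `e^J` and `e^G` are pushed through `P_{T^H}` with the operator bounds.
For `τ`, `f^J_x - f^J_{x'}` splits into its `S^J` part and its `T^J` part, which is `e^J_x -
e^J_{x'}` because the model subspace is constant. `P_{S^H}` fixes the former and sends the latter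
into `S^H ∩ T^J`; the same holds for `G`. For `ξ`, a common factor bounding the growth of two gauges
also bounds that of the gauge of the sum set (`extGauge_add_set_le`).

The operator bounds are finite because coercivity bounds the unit ball of the source gauge on its
subspace and a finite gauge grows at most linearly. -/

namespace PartlySmooth

/-! ### Gauges, sublinearity and operator bounds -/

section Gauges

variable {E : Type*} [NormedAddCommGroup E] [InnerProductSpace ℝ E]

theorem extGauge_le_of_mem {C : Set E} {v : E} {r : ℝ} (hr : 0 < r) (hv : v ∈ r • C) :
    extGauge C v ≤ ENNReal.ofReal r :=
  iInf₂_le r ⟨hr, hv⟩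

theorem le_extGauge {C : Set E} {v : E} {c : ℝ≥0∞}
    (h : ∀ r : ℝ, 0 < r → v ∈ r • C → c ≤ ENNReal.ofReal r) : c ≤ extGauge C v :=
  le_iInf₂ fun r hr => h r hr.1 hr.2

theorem extGauge_mono {C D : Set E} (h : C ⊆ D) (v : E) : extGauge D v ≤ extGauge C v :=
  le_extGauge fun _ hr hv => extGauge_le_of_mem hr (smul_set_mono h hv)

theorem smul_set_subset_of_le {C : Set E} (hC : Convex ℝ C) (h0 : (0 : E) ∈ C) {r s : ℝ}
    (hr : 0 < r) (hrs : r ≤ s) : r • C ⊆ s • C := by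
  rintro _ ⟨c, hc, rfl⟩
  have hs : 0 < s := hr.trans_le hrs
  refine ⟨(r / s) • c, hC.smul_mem_of_zero_mem h0 hc ⟨by positivity, ?_⟩, ?_⟩
  · rwa [div_le_one hs]
  · simp only [smul_smul]
    rw [mul_div_cancel₀ _ hs.ne']

theorem mem_smul_of_extGauge_lt {C : Set E} (hC : Convex ℝ C) (h0 : (0 : E) ∈ C) {v : E} {r : ℝ}
    (h : extGauge C v < ENNReal.ofReal r) : v ∈ r • C := by
  obtain ⟨s, ⟨hs, hv⟩, hsr⟩ : ∃ s : ℝ, (0 < s ∧ v ∈ s • C) ∧ ENNReal.ofReal s < ENNReal.ofReal r := by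
    simpa [extGauge, iInf_lt_iff, -ENNReal.ofReal_lt_ofReal_iff] using h
  exact smul_set_subset_of_le hC h0 hs (ENNReal.ofReal_lt_ofReal_iff'.1 hsr).1.le hv

theorem ofReal_lt_exists {c : ℝ≥0∞} {d : ℝ≥0∞} (h : c < d) :
    ∃ r : ℝ, 0 < r ∧ c < ENNReal.ofReal r ∧ ENNReal.ofReal r < d := by
  obtain ⟨q, hq1, hq2⟩ := ENNReal.lt_iff_exists_nnreal_btwn.1 h
  refine ⟨q, ?_, by simpa using hq1, by simpa using hq2⟩
  have : (0 : ℝ≥0∞) < q := pos_of_gt hq1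
  exact_mod_cast this

theorem extGauge_le_of_forall_lt {C : Set E} {v : E} {c : ℝ≥0∞}
    (h : ∀ r : ℝ, 0 < r → c < ENNReal.ofReal r → v ∈ r • C) : extGauge C v ≤ c := by
  refine le_of_forall_gt_imp_ge_of_dense fun d hd => ?_
  obtain ⟨r, hr, h1, h2⟩ := ofReal_lt_exists hd
  exact (extGauge_le_of_mem hr (h r hr h1)).trans h2.le

theorem extGauge_zero {C : Set E} (h0 : (0 : E) ∈ C) : extGauge C 0 = 0 :=
  le_antisymm (extGauge_le_of_forall_lt fun r _ _ => ⟨0, h0, smul_zero r⟩) zero_le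

theorem extGauge_smul_le {C : Set E} {t : ℝ} (ht : 0 < t) (v : E) :
    extGauge C (t • v) ≤ ENNReal.ofReal t * extGauge C v := by
  have key : ENNReal.ofReal t⁻¹ * extGauge C (t • v) ≤ extGauge C v := by
    refine le_extGauge fun r hr hv => ?_
    have h1 : t • v ∈ (t * r) • C := by
      rw [mul_smul]; exact smul_mem_smul_set hv
    calc _ ≤ ENNReal.ofReal t⁻¹ * ENNReal.ofReal (t * r) :=
          mul_le_mul_right (extGauge_le_of_mem (by positivity) h1) _
      _ = ENNReal.ofReal r := by
          rw [← ENNReal.ofReal_mul (by positivity), inv_mul_cancel_left₀ ht.ne']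
  calc extGauge C (t • v)
      = ENNReal.ofReal t * (ENNReal.ofReal t⁻¹ * extGauge C (t • v)) := by
        rw [← mul_assoc, ← ENNReal.ofReal_mul ht.le, mul_inv_cancel₀ ht.ne']; simp
    _ ≤ _ := mul_le_mul_right key _

theorem extGauge_add_le {C : Set E} (hC : Convex ℝ C) (v w : E) :
    extGauge C (v + w) ≤ extGauge C v + extGauge C w := by
  have hset : ∀ r s : ℝ, 0 < r → 0 < s → v ∈ r • C → w ∈ s • C → v + w ∈ (r + s) • C := by
    intro r s hr hs hv hw
    rw [hC.add_smul hr.le hs.le]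
    exact add_mem_add hv hw
  refine ENNReal.le_iInf₂_add_iInf₂ fun r hr s hs => ?_
  rw [← ENNReal.ofReal_add hr.1.le hs.1.le]
  exact extGauge_le_of_mem (add_pos hr.1 hs.1) (hset r s hr.1 hs.1 hr.2 hs.2)

/-- Sublinearity: subadditivity, positive homogeneity and vanishing at the origin. -/
structure IsSublinear (Γ : E → ℝ≥0∞) : Prop where
  zero : Γ 0 = 0
  add_le : ∀ v w, Γ (v + w) ≤ Γ v + Γ w
  smul_le : ∀ t : ℝ, 0 < t → ∀ v, Γ (t • v) ≤ ENNReal.ofReal t * Γ v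

theorem isSublinear_extGauge {C : Set E} (hC : Convex ℝ C) (h0 : (0 : E) ∈ C) :
    IsSublinear (extGauge C) :=
  ⟨extGauge_zero h0, extGauge_add_le hC, fun _ ht => extGauge_smul_le ht⟩

theorem IsGauge.isSublinear {Γ : E → ℝ≥0∞} (h : IsGauge Γ) : IsSublinear Γ := by
  obtain ⟨C, -, hC, h0, rfl⟩ := h
  exact isSublinear_extGauge hC h0

/-- The maximum is the gauge of the intersection `C ∩ D`, since scaling by `r > 0` commutes with
intersection. -/
theorem IsGauge.max {Γ₁ Γ₂ : E → ℝ≥0∞} (h₁ : IsGauge Γ₁) (h₂ : IsGauge Γ₂) :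
    IsGauge fun v => max (Γ₁ v) (Γ₂ v) := by
  obtain ⟨C, hC, hC', hC0, rfl⟩ := h₁
  obtain ⟨D, hD, hD', hD0, rfl⟩ := h₂
  refine ⟨C ∩ D, hC.inter hD, hC'.inter hD', ⟨hC0, hD0⟩, funext fun v => le_antisymm ?_ ?_⟩
  · exact max_le (extGauge_mono inter_subset_left v) (extGauge_mono inter_subset_right v)
  · refine extGauge_le_of_forall_lt fun r hr h => ?_
    rw [smul_set_inter₀ hr.ne']
    exact ⟨mem_smul_of_extGauge_lt hC' hC0 ((le_max_left _ _).trans_lt h),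
      mem_smul_of_extGauge_lt hD' hD0 ((le_max_right _ _).trans_lt h)⟩

/-- If `u = a + b` with `a ∈ r • A` and `b ∈ r • B`, both new gauges are at most `c * r`, so `u ∈ s
• (A' + B')` for every `s > c * r`. The hypotheses concern finite gauge values only, as the `ξ`
condition speaks only of directions in `S`. -/
theorem extGauge_add_set_le {A B : Set E} {A' B' : Set E} (hA' : Convex ℝ A') (hB' : Convex ℝ B')
    (hA0 : (0 : E) ∈ A') (hB0 : (0 : E) ∈ B') {c : ℝ≥0∞} (hc0 : c ≠ 0) (hc : c ≠ ⊤)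
    (hA : ∀ a, extGauge A a ≠ ⊤ → extGauge A' a ≤ c * extGauge A a)
    (hB : ∀ b, extGauge B b ≠ ⊤ → extGauge B' b ≤ c * extGauge B b) (u : E) :
    extGauge (A' + B') u ≤ c * extGauge (A + B) u := by
  have key : ∀ r : ℝ, 0 < r → u ∈ r • (A + B) → extGauge (A' + B') u ≤ c * ENNReal.ofReal r := by
    intro r hr hu
    rw [smul_add] at hu
    obtain ⟨a, ha, b, hb, rfl⟩ := hu
    have ha' := extGauge_le_of_mem hr ha
    have hb' := extGauge_le_of_mem hr hb
    refine extGauge_le_of_forall_lt fun s hs h => ?_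
    rw [smul_add]
    refine add_mem_add (mem_smul_of_extGauge_lt hA' hA0 (lt_of_le_of_lt ?_ h))
      (mem_smul_of_extGauge_lt hB' hB0 (lt_of_le_of_lt ?_ h))
    · exact (hA a (ne_top_of_le_ne_top ENNReal.ofReal_ne_top ha')).trans (mul_le_mul_right ha' _)
    · exact (hB b (ne_top_of_le_ne_top ENNReal.ofReal_ne_top hb')).trans (mul_le_mul_right hb' _)
  rw [mul_comm, ← ENNReal.div_le_iff_le_mul (Or.inl hc0) (Or.inl hc)]
  refine le_extGauge fun r hr hu => ENNReal.div_le_of_le_mul ?_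
  rw [mul_comm]
  exact key r hr hu

/-- Otherwise `Γ` would vanish along an unbounded ray in `V`. -/
theorem IsSublinear.eq_zero_of_coerciveOn {Γ : E → ℝ≥0∞} (hΓ : IsSublinear Γ) {V : Submodule ℝ E}
    (hV : CoerciveOn Γ V) {v : E} (hv : v ∈ V) (h : Γ v = 0) : v = 0 := by
  by_contra hne
  have ht : Tendsto (fun n : ℕ => ((n : ℝ) + 1) • v) atTop (Bornology.cobounded E ⊓ 𝓟 (V : Set E)) := by
    refine tendsto_inf.2 ⟨?_, tendsto_principal.2 (Eventually.of_forall fun n => V.smul_mem _ hv)⟩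
    rw [← tendsto_norm_atTop_iff_cobounded]
    have : (fun n : ℕ => ‖((n : ℝ) + 1) • v‖) = fun n : ℕ => ((n : ℝ) + 1) * ‖v‖ := by
      funext n; rw [norm_smul, Real.norm_of_nonneg (by positivity)]
    rw [this]
    exact (tendsto_atTop_add_const_right _ _ tendsto_natCast_atTop_atTop).atTop_mul_const
      (norm_pos_iff.2 hne)
  have h0 : (fun n : ℕ => Γ (((n : ℝ) + 1) • v)) = fun _ => 0 := by
    funext n
    have := hΓ.smul_le ((n : ℝ) + 1) (by positivity) v
    rw [h, mul_zero] at this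
    exact le_antisymm this zero_le
  have := (hV.comp ht)
  change Tendsto (fun n : ℕ => Γ (((n : ℝ) + 1) • v)) atTop (𝓝 ⊤) at this
  rw [h0] at this
  exact ENNReal.zero_ne_top (tendsto_nhds_unique tendsto_const_nhds this)

theorem CoerciveOn.exists_norm_le {Γ : E → ℝ≥0∞} {V : Submodule ℝ E}
    (hV : CoerciveOn Γ V) : ∃ R : ℝ, ∀ v ∈ V, Γ v ≤ 1 → ‖v‖ ≤ R := by
  have h := hV.eventually (lt_mem_nhds ENNReal.one_lt_top)
  rw [eventually_inf_principal] at h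
  rw [← comap_norm_atTop, eventually_comap] at h
  obtain ⟨R, hR⟩ := h.exists_forall_of_atTop
  refine ⟨R, fun v hv h1 => ?_⟩
  by_contra! hlt
  exact (hR _ hlt.le v rfl hv).not_ge h1

theorem IsSublinear.sum_le {Γ : E → ℝ≥0∞} (hΓ : IsSublinear Γ) {ι : Type*} (s : Finset ι)
    (g : ι → E) : Γ (∑ i ∈ s, g i) ≤ ∑ i ∈ s, Γ (g i) :=
  Finset.le_sum_of_subadditive Γ hΓ.zero.le hΓ.add_le s g

theorem IsSublinear.smul_le_abs {Γ : E → ℝ≥0∞} (hΓ : IsSublinear Γ) (t : ℝ) (v : E) :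
    Γ (t • v) ≤ ENNReal.ofReal |t| * max (Γ v) (Γ (-v)) := by
  rcases lt_trichotomy t 0 with h | rfl | h
  · have := hΓ.smul_le (-t) (neg_pos.2 h) (-v)
    rw [smul_neg, neg_smul, neg_neg] at this
    rw [abs_of_neg h]
    exact this.trans (mul_le_mul_right (le_max_right _ _) _)
  · simp [hΓ.zero]
  · rw [abs_of_pos h]
    exact (hΓ.smul_le t h v).trans (mul_le_mul_right (le_max_left _ _) _)

/-- Expand in an orthonormal basis of `V`. A gauge need not be even, so both signs of each basis
vector enter the constant. -/
theorem IsSublinear.exists_le_mul_norm [FiniteDimensional ℝ E] {Γ : E → ℝ≥0∞} (hΓ : IsSublinear Γ)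
    {V : Submodule ℝ E} (hV : FiniteOn Γ V) :
    ∃ K : ℝ≥0∞, K ≠ ⊤ ∧ ∀ v ∈ V, Γ v ≤ K * ENNReal.ofReal ‖v‖ := by
  let b := stdOrthonormalBasis ℝ V
  refine ⟨∑ i, max (Γ (b i)) (Γ (-(b i))), ?_, fun v hv => ?_⟩
  · refine ENNReal.sum_ne_top.2 fun i _ => ?_
    exact (max_lt (hV _ (b i).2).lt_top (hV _ (V.neg_mem (b i).2)).lt_top).ne
  · have hsum : v = ∑ i, (inner ℝ (b i) (⟨v, hv⟩ : V)) • (b i : E) := by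
      have := congrArg (Subtype.val) (b.sum_repr' ⟨v, hv⟩)
      simpa using this.symm
    rw [Finset.sum_mul]
    conv_lhs => rw [hsum]
    refine (hΓ.sum_le _ _).trans (Finset.sum_le_sum fun i _ => (hΓ.smul_le_abs _ _).trans ?_)
    rw [mul_comm]
    refine mul_le_mul_right (ENNReal.ofReal_le_ofReal ?_) _
    have := abs_real_inner_le_norm (b i) (⟨v, hv⟩ : V)
    rwa [b.norm_eq_one, one_mul] at this

/-- Rescale `v` to the unit level of `Γ₁`. When `Γ₁ v = 0` no rescaling is possible, but coercivity
forces `v = 0`. -/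
theorem apply_le_opBound_mul {V : Submodule ℝ E} {A : E →L[ℝ] E} {Γ₁ Γ₂ : E → ℝ≥0∞}
    (h₁ : IsSublinear Γ₁) (h₂ : IsSublinear Γ₂) (hfin : FiniteOn Γ₁ V) (hco : CoerciveOn Γ₁ V)
    {v : E} (hv : v ∈ V) : Γ₂ (A v) ≤ opBound V A Γ₁ Γ₂ * Γ₁ v := by
  rcases eq_or_ne (Γ₁ v) 0 with h0 | h0
  · rw [h₁.eq_zero_of_coerciveOn hco hv h0]
    simp [h₂.zero]
  have htop := hfin v hv
  set t := (Γ₁ v).toReal with ht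
  have htpos : 0 < t := ENNReal.toReal_pos h0 htop
  have hof : ENNReal.ofReal t = Γ₁ v := ENNReal.ofReal_toReal htop
  have hw : Γ₁ (t⁻¹ • v) ≤ 1 := by
    refine (h₁.smul_le _ (inv_pos.2 htpos) v).trans ?_
    rw [← hof, ← ENNReal.ofReal_mul (by positivity), inv_mul_cancel₀ htpos.ne', ENNReal.ofReal_one]
  have hb : Γ₂ (A (t⁻¹ • v)) ≤ opBound V A Γ₁ Γ₂ :=
    le_iSup₂ (f := fun (v : E) (_ : v ∈ V ∧ Γ₁ v ≤ 1) => Γ₂ (A v)) (t⁻¹ • v)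
      ⟨V.smul_mem _ hv, hw⟩
  calc Γ₂ (A v) = Γ₂ (t • A (t⁻¹ • v)) := by rw [map_smul, smul_inv_smul₀ htpos.ne']
    _ ≤ ENNReal.ofReal t * Γ₂ (A (t⁻¹ • v)) := h₂.smul_le _ htpos _
    _ ≤ _ := by rw [hof, mul_comm]; exact mul_le_mul_left hb _

theorem opBound_ne_top [FiniteDimensional ℝ E] {V W : Submodule ℝ E} {Γ₁ Γ₂ : E → ℝ≥0∞}
    (h₂ : IsSublinear Γ₂) (hco : CoerciveOn Γ₁ V) (hfin : FiniteOn Γ₂ W) :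
    opBound V W.starProjection Γ₁ Γ₂ ≠ ⊤ := by
  obtain ⟨R, hR⟩ := hco.exists_norm_le
  obtain ⟨K, hK, hKle⟩ := h₂.exists_le_mul_norm hfin
  refine ne_top_of_le_ne_top (ENNReal.mul_ne_top hK ENNReal.ofReal_ne_top) (b := K * ENNReal.ofReal R)
    (iSup₂_le fun v hv => (hKle _ (Submodule.starProjection_apply_mem _ _)).trans ?_)
  exact mul_le_mul_right (ENNReal.ofReal_le_ofReal
    ((W.norm_starProjection_apply_le v).trans (hR v hv.1 hv.2))) _

/-- Clears the denominator; finiteness of `c` excludes `q = 0 < p`. -/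
theorem le_one_add_mul_of_sub_div_le {p q c : ℝ≥0∞} (hc : c ≠ ⊤) (h : (p - q) / q ≤ c) :
    p ≤ (1 + c) * q := by
  rcases eq_or_ne q ⊤ with rfl | hq
  · simp
  have := (ENNReal.div_le_iff_le_mul (Or.inr hc) (Or.inl hq)).1 h
  rw [one_add_mul]
  exact tsub_le_iff_left.1 this

theorem sub_div_le_of_le_one_add_mul {p q c : ℝ≥0∞} (h : p ≤ (1 + c) * q) : (p - q) / q ≤ c := by
  refine ENNReal.div_le_of_le_mul (tsub_le_iff_left.2 ?_)
  rwa [one_add_mul] at h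

theorem finiteOn_max {Γ₁ Γ₂ : E → ℝ≥0∞} {V V₁ V₂ : Submodule ℝ E} (h₁ : FiniteOn Γ₁ V₁)
    (h₂ : FiniteOn Γ₂ V₂) (hV₁ : V ≤ V₁) (hV₂ : V ≤ V₂) :
    FiniteOn (fun v => max (Γ₁ v) (Γ₂ v)) V := fun v hv =>
  (max_lt (h₁ v (hV₁ hv)).lt_top (h₂ v (hV₂ hv)).lt_top).ne

theorem coerciveOn_of_le {Γ₁ Γ₂ : E → ℝ≥0∞} {V V₁ : Submodule ℝ E} (h₁ : CoerciveOn Γ₁ V₁)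
    (hV₁ : V ≤ V₁) (hle : Γ₁ ≤ Γ₂) : CoerciveOn Γ₂ V := by
  have h : Tendsto Γ₁ (Bornology.cobounded E ⊓ 𝓟 (V : Set E)) (𝓝 ⊤) :=
    h₁.mono_left (inf_le_inf_left _ (principal_mono.2 hV₁))
  exact tendsto_nhds_top_mono' h hle

end Gauges

/-! ### Lipschitz set-valued maps and selections -/

section Lipschitz

variable {E : Type*} [NormedAddCommGroup E]

theorem SetLipschitzAround.mono {F : E → Set E} {M M' : Set E} {x : E} (h : SetLipschitzAround F M x)
    (hM : M' ⊆ M) : SetLipschitzAround F M' x := by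
  obtain ⟨K, U, hU, h⟩ := h
  exact ⟨K, U, hU, fun y hy z hz => h y ⟨hy.1, hM hy.2⟩ z ⟨hz.1, hM hz.2⟩⟩

theorem SetLipschitzAround.add {F₁ F₂ : E → Set E} {M : Set E} {x : E}
    (h₁ : SetLipschitzAround F₁ M x) (h₂ : SetLipschitzAround F₂ M x) :
    SetLipschitzAround (fun y => F₁ y + F₂ y) M x := by
  obtain ⟨K₁, U₁, hU₁, h₁⟩ := h₁
  obtain ⟨K₂, U₂, hU₂, h₂⟩ := h₂
  refine ⟨K₁ + K₂, U₁ ∩ U₂, inter_mem hU₁ hU₂, ?_⟩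
  rintro y ⟨⟨hy₁, hy₂⟩, hyM⟩ z ⟨⟨hz₁, hz₂⟩, hzM⟩ _ ⟨a, ha, b, hb, rfl⟩
  obtain ⟨a', ha', hle⟩ := h₁ y ⟨hy₁, hyM⟩ z ⟨hz₁, hzM⟩ a ha
  obtain ⟨b', hb', hle'⟩ := h₂ y ⟨hy₂, hyM⟩ z ⟨hz₂, hzM⟩ b hb
  refine ⟨a' + b', add_mem_add ha' hb', ?_⟩
  change ‖a + b - (a' + b')‖ ≤ _
  rw [add_sub_add_comm, NNReal.coe_add, add_mul]
  exact (norm_add_le _ _).trans (add_le_add hle hle')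

theorem SetLipschitzAround.eventually {F : E → Set E} {M : Set E} {x : E}
    (h : SetLipschitzAround F M x) (hx : x ∈ M) {ε : ℝ} (hε : 0 < ε) :
    ∀ᶠ y in 𝓝[M] x, (∀ u ∈ F y, ∃ v ∈ F x, ‖u - v‖ < ε) ∧ ∀ v ∈ F x, ∃ u ∈ F y, ‖v - u‖ < ε := by
  obtain ⟨K, U, hU, h⟩ := h
  have hsmall : ∀ᶠ y in 𝓝 x, K * ‖y - x‖ < ε := by
    have : Tendsto (fun y => K * ‖y - x‖) (𝓝 x) (𝓝 (K * ‖x - x‖)) :=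
      Continuous.tendsto (by fun_prop) x
    refine this.eventually (gt_mem_nhds ?_)
    simpa using hε
  have hxU : x ∈ U ∩ M := ⟨mem_of_mem_nhds hU, hx⟩
  filter_upwards [self_mem_nhdsWithin, mem_nhdsWithin_of_mem_nhds hU,
    mem_nhdsWithin_of_mem_nhds hsmall] with y hyM hyU hy
  refine ⟨fun u hu => ?_, fun v hv => ?_⟩
  · obtain ⟨v, hv, hle⟩ := h y ⟨hyU, hyM⟩ x hxU u hu
    exact ⟨v, hv, hle.trans_lt hy⟩
  · obtain ⟨u, hu, hle⟩ := h x hxU y ⟨hyU, hyM⟩ v hv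
    rw [norm_sub_rev x y] at hle
    exact ⟨u, hu, hle.trans_lt hy⟩

/-- Compactness of `F x` leaves room for a uniform `ε`-thickening inside `U`, which absorbs nearby
values of `F`. -/
theorem SetLipschitzAround.upperHemicontinuousWithinAt {F : E → Set E} {M : Set E} {x : E}
    (h : SetLipschitzAround F M x) (hx : x ∈ M) (hF : IsCompact (F x)) :
    UpperHemicontinuousWithinAt F M x := by
  refine upperHemicontinuousWithinAt_iff_forall_isOpen.2 fun U hU hFU => ?_
  obtain ⟨ε, hε, hsub⟩ := hF.exists_thickening_subset_open hU hFU
  filter_upwards [h.eventually hx hε] with y hy u hu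
  obtain ⟨v, hv, hlt⟩ := hy.1 u hu
  exact hsub (Metric.mem_thickening_iff.2 ⟨v, hv, by rwa [dist_eq_norm]⟩)

theorem SetLipschitzAround.lowerHemicontinuousWithinAt {F : E → Set E} {M : Set E} {x : E}
    (h : SetLipschitzAround F M x) (hx : x ∈ M) : LowerHemicontinuousWithinAt F M x := by
  refine lowerHemicontinuousWithinAt_iff.2 ?_
  rintro U hU ⟨v, hv, hvU⟩
  obtain ⟨ε, hε, hball⟩ := Metric.isOpen_iff.1 hU v hvU
  filter_upwards [h.eventually hx hε] with y hy
  obtain ⟨u, hu, hlt⟩ := hy.2 v hv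
  exact ⟨u, hu, hball (by rwa [Metric.mem_ball, dist_comm, dist_eq_norm])⟩

theorem LipschitzAround.add {f g : E → E} {M M₁ M₂ : Set E} {x : E} (hf : LipschitzAround f M₁ x)
    (hg : LipschitzAround g M₂ x) (h₁ : M ⊆ M₁) (h₂ : M ⊆ M₂) :
    LipschitzAround (fun y => f y + g y) M x := by
  obtain ⟨K₁, U₁, hU₁, hf⟩ := hf
  obtain ⟨K₂, U₂, hU₂, hg⟩ := hg
  exact ⟨K₁ + K₂, U₁ ∩ U₂, inter_mem hU₁ hU₂,
    (hf.mono fun y hy => ⟨hy.1.1, h₁ hy.2⟩).add (hg.mono fun y hy => ⟨hy.1.2, h₂ hy.2⟩)⟩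

end Lipschitz

/-! ### Subdifferential calculus, model subspaces and model vectors -/

section Subdifferential

variable {E : Type*} [NormedAddCommGroup E] [InnerProductSpace ℝ E]

theorem convex_subdiff (J : E → ℝ) (x : E) : Convex ℝ (subdiff J x) := by
  intro u hu v hv a b ha hb hab y
  have h1 := mul_le_mul_of_nonneg_left (hu y) ha
  have h2 := mul_le_mul_of_nonneg_left (hv y) hb
  rw [inner_add_left, real_inner_smul_left, real_inner_smul_left]
  obtain rfl : b = 1 - a := by linarith
  linarith

theorem isClosed_subdiff (J : E → ℝ) (x : E) : IsClosed (subdiff J x) := by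
  have : subdiff J x = ⋂ y, {u | J x + inner ℝ u (y - x) ≤ J y} := by
    ext u; simp [subdiff]
  rw [this]
  exact isClosed_iInter fun y => isClosed_le (by fun_prop) continuous_const

theorem isCompact_subdiff [FiniteDimensional ℝ E] {J : E → ℝ} (hJ : ConvexOn ℝ univ J) (x : E) :
    IsCompact (subdiff J x) := by
  refine Metric.isCompact_of_isClosed_isBounded (isClosed_subdiff J x) ?_
  have hcont : Continuous J := hJ.locallyLipschitz.continuous
  obtain ⟨B, hB⟩ := (isCompact_closedBall x 1).bddAbove_image hcont.continuousOn
  refine (Metric.isBounded_closedBall (x := (0 : E)) (r := B - J x)).subset fun u hu => ?_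
  have hBx : J x ≤ B := hB ⟨x, by simp, rfl⟩
  rw [mem_closedBall_zero_iff]
  rcases eq_or_ne u 0 with rfl | hne
  · simpa using hBx
  have hn : 0 < ‖u‖ := norm_pos_iff.2 hne
  -- A unit step in the direction of `u` turns the subgradient inequality into `J x + ‖u‖ ≤ B`.
  have h1 := hu (x + ‖u‖⁻¹ • u)
  have h2 : J (x + ‖u‖⁻¹ • u) ≤ B := hB ⟨_, by
    simp [norm_smul, hn.ne'], rfl⟩
  rw [add_sub_cancel_left, real_inner_smul_right, real_inner_self_eq_norm_sq, sq,
    inv_mul_cancel_left₀ hn.ne'] at h1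
  linarith

theorem subdiff_add_subset (J G : E → ℝ) (x : E) :
    subdiff J x + subdiff G x ⊆ subdiff (fun y => J y + G y) x := by
  rintro _ ⟨u, hu, v, hv, rfl⟩ y
  have h1 := hu y
  have h2 := hv y
  simp only [inner_add_left]
  linarith

/-- The Moreau–Rockafellar sum rule for finite-valued convex functions. -/
theorem subdiff_add [FiniteDimensional ℝ E] {J G : E → ℝ} (hJ : ConvexOn ℝ univ J)
    (hG : ConvexOn ℝ univ G) (x : E) :
    subdiff (fun y => J y + G y) x = subdiff J x + subdiff G x := by
  refine Subset.antisymm (fun u hu => ?_) (subdiff_add_subset J G x)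
  have hJc : Continuous J := hJ.locallyLipschitz.continuous
  -- Since `u ∈ ∂(J + G)(x)`, the convex `φ` dominates the concave `ψ` below, and both vanish at
  -- `x`. An affine function squeezed between them splits `u`.
  set φ : E → ℝ := fun z => J z - J x - inner ℝ u (z - x) with hφ
  have hφconv : ConvexOn ℝ univ φ := by
    refine ⟨convex_univ, fun y _ z _ a b ha hb hab => ?_⟩
    have h1 := hJ.2 (mem_univ y) (mem_univ z) ha hb hab
    simp only [hφ, smul_eq_mul, inner_sub_right, inner_add_right, real_inner_smul_right] at h1 ⊢
    obtain rfl : b = 1 - a := by linarith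
    linarith
  have hφc : Continuous φ := by fun_prop
  set ψ : E → ℝ := fun z => G x - G z with hψ
  have hψconc : ConcaveOn ℝ univ ψ := by
    refine ⟨convex_univ, fun y _ z _ a b ha hb hab => ?_⟩
    have h1 := hG.2 (mem_univ y) (mem_univ z) ha hb hab
    simp only [hψ, smul_eq_mul] at h1 ⊢
    obtain rfl : b = 1 - a := by linarith
    linarith
  obtain ⟨F, c₀, hF1, hF2⟩ := geometric_hahn_banach_open
    (s := {p : E × ℝ | p.1 ∈ univ ∧ φ p.1 < p.2}) (t := {p : E × ℝ | p.1 ∈ univ ∧ p.2 ≤ ψ p.1})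
    hφconv.convex_strict_epigraph
    (by simpa using isOpen_lt (hφc.comp continuous_fst) continuous_snd)
    hψconc.convex_hypograph
    (disjoint_left.2 fun p hp hq => by
      have h1 := hp.2
      have h2 := hq.2
      have h3 := hu p.1
      simp only [hφ, hψ] at h1 h2
      linarith)
  set g : StrongDual ℝ E := F.comp (ContinuousLinearMap.inl ℝ E ℝ) with hg
  set c : ℝ := F (0, 1) with hc
  have hFapp : ∀ z t, F (z, t) = g z + t * c := by
    intro z t
    have : ((z, t) : E × ℝ) = (z, 0) + t • (0, 1) := by simp
    rw [this, map_add, map_smul]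
    simp [hg, hc]
  have hx1 : ∀ t > 0, g x + t * c < c₀ := fun t ht => by
    rw [← hFapp]; exact hF1 _ ⟨mem_univ _, by simpa [hφ] using ht⟩
  have hx2 : c₀ ≤ g x := by
    have := hF2 (x, 0) ⟨mem_univ _, by simp [hψ]⟩
    simpa [hFapp] using this
  -- The separating hyperplane is not vertical: `(x, 1)` lies in the open epigraph and `(x, 0)` in
  -- the hypograph.
  have hcneg : c < 0 := by
    have := hx1 1 one_pos
    linarith
  have hcn : c ≠ 0 := hcneg.ne
  have hx3 : g x ≤ c₀ := by
    refine le_of_forall_pos_le_add fun ε hε => ?_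
    have := hx1 (ε / (-c)) (div_pos hε (neg_pos.2 hcneg))
    have h : ε / (-c) * c = -ε := by field_simp
    linarith
  have hA : ∀ z, g z + φ z * c ≤ g x := fun z => by
    refine le_of_forall_pos_le_add fun ε hε => ?_
    have := hF1 (z, φ z + ε / (-c)) ⟨mem_univ _, by
      simpa using div_pos hε (neg_pos.2 hcneg)⟩
    rw [hFapp] at this
    have h : ε / (-c) * c = -ε := by field_simp
    linarith
  have hB : ∀ z, g x ≤ g z + ψ z * c := fun z => by
    have := hF2 (z, ψ z) ⟨mem_univ _, le_rfl⟩
    rw [hFapp] at this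
    linarith
  set w : E := (InnerProductSpace.toDual ℝ E).symm g with hw
  have hwapp : ∀ z, inner ℝ w z = g z := fun z => by
    simp [hw]
  have hkey : ∀ z, inner ℝ (c⁻¹ • w) (z - x) * c = g z - g x := fun z => by
    rw [real_inner_smul_left, hwapp, map_sub]
    field_simp
  -- The separating affine function is `z ↦ -⟪c⁻¹ • w, z - x⟫`. Lying above `ψ` makes `c⁻¹ • w` a
  -- subgradient of `G`; lying below `φ` makes the remainder one of `J`.
  refine ⟨u - c⁻¹ • w, fun z => ?_, c⁻¹ • w, fun z => ?_, sub_add_cancel _ _⟩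
  · rw [inner_sub_left]
    have h1 := hA z
    have h2 := hkey z
    have h3 : 0 ≤ φ z + inner ℝ (c⁻¹ • w) (z - x) := by
      by_contra! h
      have := mul_pos_of_neg_of_neg h hcneg
      linarith
    simp only [hφ] at h3
    linarith
  · have h1 := hB z
    have h2 := hkey z
    have h3 : inner ℝ (c⁻¹ • w) (z - x) + ψ z ≤ 0 := by
      by_contra! h
      have := mul_neg_of_pos_of_neg h hcneg
      linarith
    simp only [hψ] at h3
    linarith

theorem vectorSpan_add {A B : Set E} (hA : A.Nonempty) (hB : B.Nonempty) :
    vectorSpan ℝ (A + B) = vectorSpan ℝ A ⊔ vectorSpan ℝ B := by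
  obtain ⟨a₀, ha₀⟩ := hA
  obtain ⟨b₀, hb₀⟩ := hB
  refine le_antisymm ?_ (sup_le ?_ ?_)
  · rw [vectorSpan_def, Submodule.span_le]
    rintro _ ⟨_, ⟨a, ha, b, hb, rfl⟩, _, ⟨a', ha', b', hb', rfl⟩, rfl⟩
    have : (a + b) -ᵥ (a' + b') = (a -ᵥ a') + (b -ᵥ b') := add_sub_add_comm a b a' b'
    simp only [this]
    exact Submodule.add_mem_sup (vsub_mem_vectorSpan ℝ ha ha') (vsub_mem_vectorSpan ℝ hb hb')
  · rw [vectorSpan_def, Submodule.span_le]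
    rintro _ ⟨a, ha, a', ha', rfl⟩
    have : a -ᵥ a' = (a + b₀) -ᵥ (a' + b₀) := by simp
    simp only [this]
    exact vsub_mem_vectorSpan ℝ (add_mem_add ha hb₀) (add_mem_add ha' hb₀)
  · rw [vectorSpan_def, Submodule.span_le]
    rintro _ ⟨b, hb, b', hb', rfl⟩
    have : b -ᵥ b' = (a₀ + b) -ᵥ (a₀ + b') := by simp
    simp only [this]
    exact vsub_mem_vectorSpan ℝ (add_mem_add ha₀ hb) (add_mem_add ha₀ hb')

/-- Replaces the subspace topology of the affine hull by small vectors of its direction, a form that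
can be added. -/
theorem mem_intrinsicInterior_iff {A : Set E} {a : E} :
    a ∈ intrinsicInterior ℝ A ↔
      a ∈ A ∧ ∃ r > 0, ∀ w ∈ vectorSpan ℝ A, ‖w‖ < r → a + w ∈ A := by
  constructor
  · intro h
    have haA := intrinsicInterior_subset h
    obtain ⟨y, hy, rfl⟩ := mem_intrinsicInterior.1 h
    obtain ⟨r, hr, hball⟩ := Metric.mem_nhds_iff.1 (mem_interior_iff_mem_nhds.1 hy)
    refine ⟨haA, r, hr, fun w hw hwr => ?_⟩
    have hmem : (y : E) + w ∈ affineSpan ℝ A := by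
      have := AffineSubspace.vadd_mem_of_mem_direction
        (by rwa [direction_affineSpan] : w ∈ (affineSpan ℝ A).direction) y.2
      rwa [vadd_eq_add, add_comm] at this
    have hin : (⟨y + w, hmem⟩ : affineSpan ℝ A) ∈ Metric.ball y r := by
      rw [Metric.mem_ball, Subtype.dist_eq]
      simpa using hwr
    exact hball hin
  · rintro ⟨haA, r, hr, h⟩
    have hspan := subset_affineSpan ℝ A haA
    refine mem_intrinsicInterior.2 ⟨⟨a, hspan⟩, ?_, rfl⟩
    refine mem_interior_iff_mem_nhds.2 (Metric.mem_nhds_iff.2 ⟨r, hr, fun z hz => ?_⟩)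
    have hz' : ‖(z : E) - a‖ < r := by
      rw [Metric.mem_ball, Subtype.dist_eq] at hz
      rwa [← dist_eq_norm]
    have := h (z - a) (by
      rw [← direction_affineSpan]
      exact AffineSubspace.vsub_mem_direction z.2 hspan) hz'
    simpa using this

/-- Addition `V × W → V ⊔ W` is onto, so the open mapping theorem provides preimages with norm
control. -/
theorem exists_sup_decomposition [FiniteDimensional ℝ E] (V W : Submodule ℝ E) :
    ∃ C > 0, ∀ u ∈ V ⊔ W, ∃ v ∈ V, ∃ w ∈ W, v + w = u ∧ ‖v‖ ≤ C * ‖u‖ ∧ ‖w‖ ≤ C * ‖u‖ := by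
  let F : (V × W) →ₗ[ℝ] (V ⊔ W : Submodule ℝ E) :=
    (LinearMap.coprod V.subtype W.subtype).codRestrict (V ⊔ W)
      fun p => Submodule.add_mem_sup p.1.2 p.2.2
  have hF : Function.Surjective F := by
    rintro ⟨u, hu⟩
    obtain ⟨v, hv, w, hw, rfl⟩ := Submodule.mem_sup.1 hu
    exact ⟨(⟨v, hv⟩, ⟨w, hw⟩), rfl⟩
  obtain ⟨C, hC, h⟩ := ContinuousLinearMap.exists_preimage_norm_le (LinearMap.toContinuousLinearMap F) hF
  refine ⟨C, hC, fun u hu => ?_⟩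
  obtain ⟨p, hp, hpn⟩ := h ⟨u, hu⟩
  exact ⟨p.1, p.1.2, p.2, p.2.2, congrArg Subtype.val hp, (norm_fst_le p).trans hpn,
    (norm_snd_le p).trans hpn⟩

/-- A small direction of `A + B` splits into comparably small directions of `A` and `B`, each
admissible at its own point. -/
theorem add_mem_intrinsicInterior_add [FiniteDimensional ℝ E] {A B : Set E} {a b : E}
    (ha : a ∈ intrinsicInterior ℝ A) (hb : b ∈ intrinsicInterior ℝ B) :
    a + b ∈ intrinsicInterior ℝ (A + B) := by
  obtain ⟨haA, r, hr, h1⟩ := mem_intrinsicInterior_iff.1 ha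
  obtain ⟨hbB, s, hs, h2⟩ := mem_intrinsicInterior_iff.1 hb
  obtain ⟨C, hC, hdec⟩ := exists_sup_decomposition (vectorSpan ℝ A) (vectorSpan ℝ B)
  refine mem_intrinsicInterior_iff.2 ⟨add_mem_add haA hbB, min r s / C, by positivity, ?_⟩
  intro u hu hun
  rw [vectorSpan_add ⟨a, haA⟩ ⟨b, hbB⟩] at hu
  obtain ⟨v, hv, w, hw, rfl, hvn, hwn⟩ := hdec u hu
  rw [lt_div_iff₀' hC] at hun
  rw [add_add_add_comm]
  exact add_mem_add (h1 v hv (hvn.trans_lt (hun.trans_le (min_le_left _ _))))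
    (h2 w hw (hwn.trans_lt (hun.trans_le (min_le_right _ _))))

theorem normalSubspace_eq_vectorSpan (J : E → ℝ) (x : E) :
    normalSubspace J x = vectorSpan ℝ (subdiff J x) :=
  direction_affineSpan ℝ _

theorem sub_mem_normalSubspace {J : E → ℝ} {x u v : E} (hu : u ∈ subdiff J x)
    (hv : v ∈ subdiff J x) : u - v ∈ normalSubspace J x := by
  rw [normalSubspace_eq_vectorSpan]
  exact vsub_mem_vectorSpan ℝ hu hv

theorem normalSubspace_add [FiniteDimensional ℝ E] {J G : E → ℝ} (hJ : ConvexOn ℝ univ J)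
    (hG : ConvexOn ℝ univ G) {x : E} (hJx : (subdiff J x).Nonempty) (hGx : (subdiff G x).Nonempty) :
    normalSubspace (fun y => J y + G y) x = normalSubspace J x ⊔ normalSubspace G x := by
  simp only [normalSubspace_eq_vectorSpan]
  rw [subdiff_add hJ hG, vectorSpan_add hJx hGx]

theorem modelSubspace_add [FiniteDimensional ℝ E] {J G : E → ℝ} (hJ : ConvexOn ℝ univ J)
    (hG : ConvexOn ℝ univ G) {x : E} (hJx : (subdiff J x).Nonempty) (hGx : (subdiff G x).Nonempty) :
    modelSubspace (fun y => J y + G y) x = modelSubspace J x ⊓ modelSubspace G x := by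
  simp only [modelSubspace]
  rw [normalSubspace_add hJ hG hJx hGx, Submodule.inf_orthogonal]

/-- The affine hull is `u + S`, whose point nearest to `0` is the component of `u` orthogonal to
`S`. Any subgradient therefore computes `e_x`. -/
theorem modelVector_eq_starProjection [FiniteDimensional ℝ E] {J : E → ℝ} {x u : E}
    (hu : u ∈ subdiff J x) : modelVector J x = (modelSubspace J x).starProjection u := by
  have hmem : u ∈ affHull J x := subset_affineSpan ℝ _ hu
  have hne : Nonempty (affHull J x) := ⟨⟨u, hmem⟩⟩
  rw [modelVector, dif_pos hne]
  have h1 := EuclideanGeometry.orthogonalProjection_vsub_mem_direction_orthogonal (𝕜 := ℝ) (affHull J x) (0 : E)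
  have h2 := EuclideanGeometry.vsub_orthogonalProjection_mem_direction (𝕜 := ℝ) (0 : E) hmem
  refine (Submodule.eq_starProjection_of_mem_orthogonal ?_ ?_).symm
  · simpa [modelSubspace, normalSubspace] using h1
  · rw [modelSubspace, Submodule.orthogonal_orthogonal]
    exact h2

theorem modelVector_mem [FiniteDimensional ℝ E] {J : E → ℝ} {x u : E}
    (hu : u ∈ subdiff J x) : modelVector J x ∈ modelSubspace J x := by
  rw [modelVector_eq_starProjection hu]
  exact Submodule.starProjection_apply_mem _ _

/-- Since `T^H` lies in `T^J` and in `T^G`, projecting first onto the larger space changes nothing.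
-/
theorem modelVector_add [FiniteDimensional ℝ E] {J G : E → ℝ} (hJ : ConvexOn ℝ univ J)
    (hG : ConvexOn ℝ univ G) {x : E} (hJx : (subdiff J x).Nonempty) (hGx : (subdiff G x).Nonempty) :
    modelVector (fun y => J y + G y) x =
      (modelSubspace (fun y => J y + G y) x).starProjection (modelVector J x + modelVector G x) := by
  obtain ⟨u, hu⟩ := hJx
  obtain ⟨v, hv⟩ := hGx
  have hT := modelSubspace_add hJ hG ⟨u, hu⟩ ⟨v, hv⟩
  have huv : u + v ∈ subdiff (fun y => J y + G y) x := subdiff_add_subset J G x (add_mem_add hu hv)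
  rw [modelVector_eq_starProjection hu, modelVector_eq_starProjection hv,
    modelVector_eq_starProjection huv, map_add, map_add]
  have key : ∀ {V W : Submodule ℝ E}, V ≤ W → ∀ z, V.starProjection (W.starProjection z) =
      V.starProjection z := fun {V W} h z =>
    congrArg (fun L : E →L[ℝ] E => L z) (Submodule.starProjection_comp_starProjection_of_le h)
  rw [key (hT ▸ inf_le_left), key (hT ▸ inf_le_right)]

/-- The defining map is the projection onto `Tᗮ`, read in orthonormal coordinates. -/
theorem isC2ManifoldAt_submodule [FiniteDimensional ℝ E] {T : Submodule ℝ E} {x : E} (hx : x ∈ T) :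
    IsC2ManifoldAt (T : Set E) x T := by
  let b := stdOrthonormalBasis ℝ Tᗮ
  let Φ : E →L[ℝ] EuclideanSpace ℝ (Fin (Module.finrank ℝ Tᗮ)) :=
    (b.repr.toContinuousLinearEquiv : Tᗮ →L[ℝ] _).comp Tᗮ.orthogonalProjectionOnto
  have hker : ∀ v, v ∈ T ↔ Φ v = 0 := fun v => by
    simp [Φ]
  refine ⟨hx, _, Φ, Φ.contDiff.contDiffAt, ?_, ?_, ?_⟩
  · rw [Φ.fderiv]
    intro z
    exact ⟨b.repr.symm z, by simp [Φ]⟩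
  · rwa [Φ.fderiv]
  · exact Eventually.of_forall hker

theorem IsC2OnAround.add {J G : E → ℝ} {M M₁ M₂ : Set E} {x : E} (hJ : IsC2OnAround J M₁ x)
    (hG : IsC2OnAround G M₂ x) (h₁ : M ⊆ M₁) (h₂ : M ⊆ M₂) :
    IsC2OnAround (fun y => J y + G y) M x := by
  obtain ⟨J', hJ', hJe⟩ := hJ
  obtain ⟨G', hG', hGe⟩ := hG
  refine ⟨fun y => J' y + G' y, hJ'.add hG', ?_⟩
  filter_upwards [nhdsWithin_mono x h₁ hJe, nhdsWithin_mono x h₂ hGe] with y hy hy'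
  rw [hy, hy']

end Subdifferential

/-! ### Subdifferential gauges and splitting of subgradient differences -/

section SubdifferentialGauge

variable {E : Type*} [NormedAddCommGroup E] [InnerProductSpace ℝ E]

theorem convex_translated_subdiff (J : E → ℝ) (f x : E) : Convex ℝ {v | f + v ∈ subdiff J x} :=
  (convex_subdiff J x).translate_preimage_right f

theorem zero_mem_translated_subdiff {J : E → ℝ} {f x : E} (hf : f ∈ subdiff J x) :
    (0 : E) ∈ {v | f + v ∈ subdiff J x} := by
  simpa using hf

theorem isSublinear_subdiffGauge {J : E → ℝ} {f x : E} (hf : f ∈ subdiff J x) :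
    IsSublinear (subdiffGauge J f x) :=
  isSublinear_extGauge (convex_translated_subdiff J f x) (zero_mem_translated_subdiff hf)

theorem finiteOn_subdiffGauge {J : E → ℝ} {f x : E} (hf : f ∈ intrinsicInterior ℝ (subdiff J x)) :
    FiniteOn (subdiffGauge J f x) (normalSubspace J x) := by
  obtain ⟨-, r, hr, h⟩ := mem_intrinsicInterior_iff.1 hf
  intro v hv
  have hpos : 0 < r / (‖v‖ + 1) := by positivity
  refine ne_top_of_le_ne_top ENNReal.ofReal_ne_top
    (extGauge_le_of_mem (inv_pos.2 hpos) ⟨(r / (‖v‖ + 1)) • v, ?_, inv_smul_smul₀ hpos.ne' v⟩)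
  refine h _ (Submodule.smul_mem _ _ (normalSubspace_eq_vectorSpan J x ▸ hv)) ?_
  rw [norm_smul, Real.norm_of_nonneg hpos.le, div_mul_eq_mul_div, div_lt_iff₀ (by positivity)]
  exact mul_lt_mul_of_pos_left (lt_add_one _) hr

theorem mem_normalSubspace_of_subdiffGauge_ne_top {J : E → ℝ} {f x v : E} (hf : f ∈ subdiff J x)
    (hv : subdiffGauge J f x v ≠ ⊤) : v ∈ normalSubspace J x := by
  obtain ⟨r, -, hlt, -⟩ := ofReal_lt_exists hv.lt_top
  obtain ⟨c, hc, rfl⟩ := mem_smul_of_extGauge_lt (convex_translated_subdiff J f x)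
    (zero_mem_translated_subdiff hf) hlt
  refine Submodule.smul_mem _ _ ?_
  simpa using sub_mem_normalSubspace hc hf

/-- Adding `g ∈ ∂G(x)` shows `∂J(x) - f ⊆ ∂H(x) - (f + g)`, and a larger set has a smaller gauge. -/
theorem subdiffGauge_add_le_left {J G : E → ℝ} {f g x : E} (hg : g ∈ subdiff G x) (v : E) :
    subdiffGauge (fun y => J y + G y) (f + g) x v ≤ subdiffGauge J f x v := by
  refine extGauge_mono (fun w hw => ?_) v
  have := subdiff_add_subset J G x (add_mem_add hw hg)
  rwa [add_right_comm] at this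

theorem subdiffGauge_add_le_right {J G : E → ℝ} {f g x : E} (hf : f ∈ subdiff J x) (v : E) :
    subdiffGauge (fun y => J y + G y) (f + g) x v ≤ subdiffGauge G g x v := by
  refine extGauge_mono (fun w hw => ?_) v
  have := subdiff_add_subset J G x (add_mem_add hf hw)
  rwa [← add_assoc] at this

theorem subdiffGauge_add_eq [FiniteDimensional ℝ E] {J G : E → ℝ} (hJ : ConvexOn ℝ univ J)
    (hG : ConvexOn ℝ univ G) (f g x : E) :
    subdiffGauge (fun y => J y + G y) (f + g) x =
      extGauge ({v | f + v ∈ subdiff J x} + {v | g + v ∈ subdiff G x}) := by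
  unfold subdiffGauge
  congr 1
  ext v
  rw [mem_ofPred_eq, subdiff_add hJ hG]
  constructor
  · rintro ⟨a, ha, b, hb, hab⟩
    refine ⟨a - f, by simpa using ha, b - g, by simpa using hb, ?_⟩
    change a + b = _ at hab
    change a - f + (b - g) = v
    rw [← add_sub_add_comm, hab, add_sub_cancel_left]
  · rintro ⟨a, ha, b, hb, rfl⟩
    exact ⟨f + a, ha, g + b, hb, add_add_add_comm _ _ _ _⟩

/-- A finite gauge value already places `u` in `S`, so only `u = 0` escapes the supremum. -/
theorem subdiffGauge_le_of_iSup_le {J : E → ℝ} {f f' x x' : E} (hf : f ∈ subdiff J x)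
    (hf' : f' ∈ subdiff J x') {c : ℝ≥0∞} (hc : c ≠ ⊤)
    (h : ⨆ (u : E) (_ : u ∈ normalSubspace J x ∧ u ≠ 0),
      (subdiffGauge J f' x' u - subdiffGauge J f x u) / subdiffGauge J f x u ≤ c)
    {u : E} (hu : subdiffGauge J f x u ≠ ⊤) :
    subdiffGauge J f' x' u ≤ (1 + c) * subdiffGauge J f x u := by
  rcases eq_or_ne u 0 with rfl | hne
  · rw [(isSublinear_subdiffGauge hf').zero]
    exact zero_le
  · exact le_one_add_mul_of_sub_div_le hc
      ((le_iSup₂ (f := fun (u : E) (_ : u ∈ normalSubspace J x ∧ u ≠ 0) =>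
        (subdiffGauge J f' x' u - subdiffGauge J f x u) / subdiffGauge J f x u) u
        ⟨mem_normalSubspace_of_subdiffGauge_ne_top hf hu, hne⟩).trans h)

/-- If `S ≤ W`, then the projections onto `W` and `W ⊓ Sᗮ` agree on `Sᗮ`. -/
theorem starProjection_eq_of_mem_orthogonal [FiniteDimensional ℝ E] {S W : Submodule ℝ E}
    (hSW : S ≤ W) {v : E} (hv : v ∈ Sᗮ) :
    W.starProjection v = (W ⊓ Sᗮ).starProjection v := by
  refine (Submodule.eq_starProjection_of_mem_orthogonal ?_ ?_).symm
  · refine ⟨Submodule.starProjection_apply_mem _ _, ?_⟩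
    -- The residual lies in `Wᗮ ≤ Sᗮ`, so the projection of `v` onto `W` stays in `Sᗮ`.
    have h := Submodule.orthogonal_le hSW (W.sub_starProjection_mem_orthogonal v)
    simpa using Submodule.sub_mem _ hv h
  · exact Submodule.orthogonal_le inf_le_left (W.sub_starProjection_mem_orthogonal v)

/-- The `T` component of `u - u'` is the difference of model vectors because `T` is the same at `x`
and `x'`. The `S` component is fixed by the projection onto `W ⊇ S`. -/
theorem starProjection_normalSubspace_sub [FiniteDimensional ℝ E] {J : E → ℝ} {x x' u u' : E}
    {W : Submodule ℝ E} (hW : normalSubspace J x ≤ W) (hT : modelSubspace J x = modelSubspace J x')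
    (hu : u ∈ subdiff J x) (hu' : u' ∈ subdiff J x') :
    W.starProjection (u - u') = (normalSubspace J x).starProjection (u - u') +
      (W ⊓ modelSubspace J x).starProjection (modelVector J x - modelVector J x') := by
  have hmem : modelVector J x - modelVector J x' ∈ modelSubspace J x :=
    Submodule.sub_mem _ (modelVector_mem hu) (hT ▸ modelVector_mem hu')
  have hdec : u - u' = (normalSubspace J x).starProjection (u - u') +
      (modelVector J x - modelVector J x') := by
    rw [modelVector_eq_starProjection hu, modelVector_eq_starProjection hu', ← hT, ← map_sub]
    exact ((normalSubspace J x).starProjection_add_starProjection_orthogonal (u - u')).symm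
  conv_lhs => rw [hdec, map_add]
  congr 1
  · exact Submodule.starProjection_eq_self_iff.2 (hW (Submodule.starProjection_apply_mem _ _))
  · exact starProjection_eq_of_mem_orthogonal hW hmem

end SubdifferentialGauge

/-! ### The sum rule -/

section Sum

variable {E : Type*} [NormedAddCommGroup E] [InnerProductSpace ℝ E] [FiniteDimensional ℝ E]
  {x : E} {J G : E → ℝ} {ΓJ ΓG : E → ℝ≥0∞} {fJ fG : E → E} {νJ μJ τJ ξJ νG μG τG ξG : ℝ≥0∞}

theorem PSFL.mem_modelSubspace (hJ : PSFL x ΓJ fJ νJ μJ τJ ξJ J) : x ∈ modelSubspace J x :=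
  hJ.partlySmooth.sharp.1

theorem PSFL.convex (hJ : PSFL x ΓJ fJ νJ μJ τJ ξJ J) : ConvexOn ℝ univ J :=
  hJ.partlySmooth.convex

theorem PSFL.mem_subdiff (hJ : PSFL x ΓJ fJ νJ μJ τJ ξJ J) {y : E} (hy : y ∈ modelSubspace J x) :
    fJ y ∈ subdiff J y :=
  intrinsicInterior_subset (hJ.selection y hy)

theorem PSFL.modelVector_sub_mem (hJ : PSFL x ΓJ fJ νJ μJ τJ ξJ J) {y : E}
    (hy : y ∈ modelSubspace J x) (hν : ΓJ (x - y) ≤ νJ) :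
    modelVector J x - modelVector J y ∈ modelSubspace J x :=
  Submodule.sub_mem _ (modelVector_mem (hJ.mem_subdiff hJ.mem_modelSubspace))
    (hJ.nu_stable y hy hν ▸ modelVector_mem (hJ.mem_subdiff hy))

theorem PSFL.apply_modelVector_sub_le (hJ : PSFL x ΓJ fJ νJ μJ τJ ξJ J) {Γ : E → ℝ≥0∞}
    (hΓ : IsSublinear Γ) (A : E →L[ℝ] E) {y : E} (hy : y ∈ modelSubspace J x)
    (hν : ΓJ (x - y) < νJ) :
    Γ (A (modelVector J x - modelVector J y)) ≤
      μJ * opBound (modelSubspace J x) A ΓJ Γ * ΓJ (x - y) := by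
  refine (apply_le_opBound_mul hJ.isGauge.isSublinear hΓ hJ.gauge_finite hJ.gauge_coercive
    (hJ.modelVector_sub_mem hy hν.le)).trans ?_
  rw [mul_comm μJ, mul_assoc]
  exact mul_le_mul_right (hJ.mu_stable y hy hν) _

theorem PSFL.subdiffGauge_le (hJ : PSFL x ΓJ fJ νJ μJ τJ ξJ J) {y : E}
    (hy : y ∈ modelSubspace J x) (hν : ΓJ (x - y) < νJ) {c : ℝ≥0∞} (hc : ξJ * ΓJ (x - y) ≤ c)
    {u : E} (hu : subdiffGauge J (fJ x) x u ≠ ⊤) :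
    subdiffGauge J (fJ y) y u ≤ (1 + c) * subdiffGauge J (fJ x) x u := by
  have hfin : ξJ * ΓJ (x - y) ≠ ⊤ := ENNReal.mul_ne_top hJ.xi_ne_top
    (hJ.gauge_finite _ (Submodule.sub_mem _ hJ.mem_modelSubspace hy))
  refine (subdiffGauge_le_of_iSup_le (hJ.mem_subdiff hJ.mem_modelSubspace) (hJ.mem_subdiff hy) hfin
    (hJ.xi_stable y hy hν) hu).trans ?_
  gcongr

theorem PSFL.modelSubspace_add_eq (hJ : PSFL x ΓJ fJ νJ μJ τJ ξJ J)
    (hG : PSFL x ΓG fG νG μG τG ξG G) {y : E} (hyJ : y ∈ modelSubspace J x)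
    (hyG : y ∈ modelSubspace G x) :
    modelSubspace (fun z => J z + G z) y = modelSubspace J y ⊓ modelSubspace G y :=
  modelSubspace_add hJ.convex hG.convex ⟨_, hJ.mem_subdiff hyJ⟩ ⟨_, hG.mem_subdiff hyG⟩

theorem PSFL.isPartlySmoothAt_add (hJ : PSFL x ΓJ fJ νJ μJ τJ ξJ J)
    (hG : PSFL x ΓG fG νG μG τG ξG G) :
    IsPartlySmoothAt (fun y => J y + G y) (modelSubspace (fun y => J y + G y) x) x ∧
    SetLipschitzAround (subdiff fun y => J y + G y) (modelSubspace (fun y => J y + G y) x) x := by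
  have hxJ := hJ.mem_modelSubspace
  have hxG := hG.mem_modelSubspace
  have hT := hJ.modelSubspace_add_eq hG hxJ hxG
  have hTJ : modelSubspace (fun y => J y + G y) x ≤ modelSubspace J x := hT ▸ inf_le_left
  have hTG : modelSubspace (fun y => J y + G y) x ≤ modelSubspace G x := hT ▸ inf_le_right
  have hconv : ConvexOn ℝ univ fun y => J y + G y := hJ.convex.add hG.convex
  have hx : x ∈ modelSubspace (fun y => J y + G y) x := hT ▸ ⟨hxJ, hxG⟩
  have hlip : SetLipschitzAround (subdiff fun y => J y + G y)
      (modelSubspace (fun y => J y + G y) x) x := by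
    rw [funext fun y => subdiff_add hJ.convex hG.convex y]
    exact (hJ.subdiff_lipschitz.mono hTJ).add (hG.subdiff_lipschitz.mono hTG)
  exact ⟨⟨hconv, hJ.partlySmooth.smooth.add hG.partlySmooth.smooth hTJ hTG,
    isC2ManifoldAt_submodule hx, hlip.upperHemicontinuousWithinAt hx (isCompact_subdiff hconv x),
    hlip.lowerHemicontinuousWithinAt hx⟩, hlip⟩

theorem PSFL.intrinsicInterior_add (hJ : PSFL x ΓJ fJ νJ μJ τJ ξJ J)
    (hG : PSFL x ΓG fG νG μG τG ξG G) {y : E} (hyJ : y ∈ modelSubspace J x)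
    (hyG : y ∈ modelSubspace G x) :
    fJ y + fG y ∈ intrinsicInterior ℝ (subdiff (fun z => J z + G z) y) := by
  rw [subdiff_add hJ.convex hG.convex]
  exact add_mem_intrinsicInterior_add (hJ.selection y hyJ) (hG.selection y hyG)

/-- The sum rule for partly smooth functions with Lipschitz subdifferentials. -/
theorem PSFL.add (hJ : PSFL x ΓJ fJ νJ μJ τJ ξJ J) (hG : PSFL x ΓG fG νG μG τG ξG G)
    {H : E → ℝ} {ΓH : E → ℝ≥0∞} {fH : E → E} (hH : H = fun y => J y + G y)
    (hΓH : ΓH = fun v => max (ΓJ v) (ΓG v)) (hfH : fH = fun y => fJ y + fG y)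
    {TJ TG TH SH : Submodule ℝ E} (hTJ : TJ = modelSubspace J x) (hTG : TG = modelSubspace G x)
    (hTH : TH = modelSubspace H x) (hSH : SH = normalSubspace H x) :
    (opBound TJ TH.starProjection ΓJ ΓH ≠ ⊤ ∧
      opBound TG TH.starProjection ΓG ΓH ≠ ⊤ ∧
      opBound TJ (SH ⊓ TJ).starProjection ΓJ (subdiffGauge H (fH x) x) ≠ ⊤ ∧
      opBound TG (SH ⊓ TG).starProjection ΓG (subdiffGauge H (fH x) x) ≠ ⊤) ∧
    PSFL x ΓH fH
      (min νJ νG)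
      (μJ * opBound TJ TH.starProjection ΓJ ΓH + μG * opBound TG TH.starProjection ΓG ΓH)
      (τJ + τG
        + μJ * opBound TJ (SH ⊓ TJ).starProjection ΓJ (subdiffGauge H (fH x) x)
        + μG * opBound TG (SH ⊓ TG).starProjection ΓG (subdiffGauge H (fH x) x))
      (max ξJ ξG)
      H := by
  have hxJ := hJ.mem_modelSubspace
  have hxG := hG.mem_modelSubspace
  have hfJx := hJ.mem_subdiff hxJ
  have hfGx := hG.mem_subdiff hxG
  have hT : TH = TJ ⊓ TG := by
    rw [hTH, hH, hTJ, hTG]; exact hJ.modelSubspace_add_eq hG hxJ hxG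
  have hS : SH = normalSubspace J x ⊔ normalSubspace G x := by
    rw [hSH, hH]; exact normalSubspace_add hJ.convex hG.convex ⟨_, hfJx⟩ ⟨_, hfGx⟩
  have hTHJ : TH ≤ modelSubspace J x := by rw [hT, hTJ]; exact inf_le_left
  have hTHG : TH ≤ modelSubspace G x := by rw [hT, hTG]; exact inf_le_right
  have hgauge : IsGauge ΓH := hΓH ▸ hJ.isGauge.max hG.isGauge
  have hfin : FiniteOn ΓH TH := hΓH ▸ finiteOn_max hJ.gauge_finite hG.gauge_finite hTHJ hTHG
  have hri : ∀ y ∈ TH, fH y ∈ intrinsicInterior ℝ (subdiff H y) := fun y hy => by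
    rw [hH, hfH]; exact hJ.intrinsicInterior_add hG (hTHJ hy) (hTHG hy)
  have hxH : x ∈ TH := hT ▸ ⟨hTJ ▸ hxJ, hTG ▸ hxG⟩
  have hHfin : FiniteOn (subdiffGauge H (fH x) x) SH := hSH ▸ finiteOn_subdiffGauge (hri x hxH)
  have hHsub : IsSublinear (subdiffGauge H (fH x) x) :=
    isSublinear_subdiffGauge (intrinsicInterior_subset (hri x hxH))
  have hJH : ∀ v, ΓJ v ≤ ΓH v := fun v => by rw [hΓH]; exact le_max_left _ _
  have hGH : ∀ v, ΓG v ≤ ΓH v := fun v => by rw [hΓH]; exact le_max_right _ _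
  have hb₁ : opBound TJ TH.starProjection ΓJ ΓH ≠ ⊤ :=
    opBound_ne_top hgauge.isSublinear (hTJ ▸ hJ.gauge_coercive) hfin
  have hb₂ : opBound TG TH.starProjection ΓG ΓH ≠ ⊤ :=
    opBound_ne_top hgauge.isSublinear (hTG ▸ hG.gauge_coercive) hfin
  have hb₃ : opBound TJ (SH ⊓ TJ).starProjection ΓJ (subdiffGauge H (fH x) x) ≠ ⊤ :=
    opBound_ne_top hHsub (hTJ ▸ hJ.gauge_coercive) fun v hv => hHfin v hv.1
  have hb₄ : opBound TG (SH ⊓ TG).starProjection ΓG (subdiffGauge H (fH x) x) ≠ ⊤ :=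
    opBound_ne_top hHsub (hTG ▸ hG.gauge_coercive) fun v hv => hHfin v hv.1
  have hstable : ∀ y ∈ TH, ΓH (x - y) ≤ min νJ νG → TH = modelSubspace H y := fun y hy hν => by
    rw [hT, hTJ, hTG, hJ.nu_stable y (hTHJ hy) ((hJH _).trans (hν.trans (min_le_left _ _))),
      hG.nu_stable y (hTHG hy) ((hGH _).trans (hν.trans (min_le_right _ _))), hH]
    exact (hJ.modelSubspace_add_eq hG (hTHJ hy) (hTHG hy)).symm
  have hvec : ∀ y ∈ TH, modelVector H y =
      (modelSubspace H y).starProjection (modelVector J y + modelVector G y) := fun y hy => by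
    rw [hH]
    exact modelVector_add hJ.convex hG.convex ⟨_, hJ.mem_subdiff (hTHJ hy)⟩
      ⟨_, hG.mem_subdiff (hTHG hy)⟩
  have hνJ : ∀ {y}, ΓH (x - y) < min νJ νG → ΓJ (x - y) < νJ := fun h =>
    (hJH _).trans_lt (h.trans_le (min_le_left _ _))
  have hνG : ∀ {y}, ΓH (x - y) < min νJ νG → ΓG (x - y) < νG := fun h =>
    (hGH _).trans_lt (h.trans_le (min_le_right _ _))
  refine ⟨⟨hb₁, hb₂, hb₃, hb₄⟩, ?_⟩
  constructor
  · rw [hH]; exact (hJ.isPartlySmoothAt_add hG).1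
  · rw [hH]; exact (hJ.isPartlySmoothAt_add hG).2
  · exact hgauge
  · exact hTH ▸ hfin
  · exact hTH ▸ coerciveOn_of_le hJ.gauge_coercive hTHJ hJH
  · exact hTH ▸ hri
  · rw [hfH, ← hTH]
    exact hJ.selection_lipschitz.add hG.selection_lipschitz hTHJ hTHG
  · exact ENNReal.add_ne_top.2 ⟨ENNReal.mul_ne_top hJ.mu_ne_top hb₁,
      ENNReal.mul_ne_top hG.mu_ne_top hb₂⟩
  · exact ENNReal.add_ne_top.2 ⟨ENNReal.add_ne_top.2 ⟨ENNReal.add_ne_top.2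
      ⟨hJ.tau_ne_top, hG.tau_ne_top⟩, ENNReal.mul_ne_top hJ.mu_ne_top hb₃⟩,
      ENNReal.mul_ne_top hG.mu_ne_top hb₄⟩
  · exact (max_lt hJ.xi_ne_top.lt_top hG.xi_ne_top.lt_top).ne
  · rw [← hTH]; exact hstable
  · rw [← hTH]
    intro y hy hν
    -- Stability makes both model vectors of `H` projections onto the same `TH`, so their difference
    -- is one projection.
    rw [hvec x hxH, hvec y hy, ← hstable y hy hν.le, ← hTH, ← map_sub, add_sub_add_comm, map_add,
      add_mul]
    refine (hgauge.isSublinear.add_le _ _).trans (add_le_add ?_ ?_)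
    · rw [hTJ]
      refine (hJ.apply_modelVector_sub_le hgauge.isSublinear _ (hTHJ hy) (hνJ hν)).trans ?_
      exact mul_le_mul_right (hJH _) _
    · rw [hTG]
      refine (hG.apply_modelVector_sub_le hgauge.isSublinear _ (hTHG hy) (hνG hν)).trans ?_
      exact mul_le_mul_right (hGH _) _
  · rw [← hTH]
    intro y hy hν
    have hyJ := hTHJ hy
    have hyG := hTHG hy
    have hJle : ∀ v, subdiffGauge H (fH x) x v ≤ subdiffGauge J (fJ x) x v := by
      rw [hH, hfH]; exact subdiffGauge_add_le_left hfGx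
    have hGle : ∀ v, subdiffGauge H (fH x) x v ≤ subdiffGauge G (fG x) x v := by
      rw [hH, hfH]; exact subdiffGauge_add_le_right hfJx
    have hsplit : SH.starProjection (fH x - fH y) =
        ((normalSubspace J x).starProjection (fJ x - fJ y) +
          (normalSubspace G x).starProjection (fG x - fG y)) +
        (SH ⊓ TJ).starProjection (modelVector J x - modelVector J y) +
        (SH ⊓ TG).starProjection (modelVector G x - modelVector G y) := by
      have h1 := starProjection_normalSubspace_sub (W := SH) (hS ▸ le_sup_left)
        (hJ.nu_stable y hyJ (hνJ hν).le) hfJx (hJ.mem_subdiff hyJ)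
      have h2 := starProjection_normalSubspace_sub (W := SH) (hS ▸ le_sup_right)
        (hG.nu_stable y hyG (hνG hν).le) hfGx (hG.mem_subdiff hyG)
      rw [← hTJ] at h1
      rw [← hTG] at h2
      rw [hfH]
      simp only []
      rw [add_sub_add_comm, map_add, h1, h2]
      abel
    rw [← hSH, hsplit, add_mul, add_mul, add_mul]
    refine (hHsub.add_le _ _).trans (add_le_add ((hHsub.add_le _ _).trans
      (add_le_add ((hHsub.add_le _ _).trans (add_le_add ?_ ?_)) ?_)) ?_)
    · exact (hJle _).trans ((hJ.tau_stable y hyJ (hνJ hν)).trans (mul_le_mul_right (hJH _) _))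
    · exact (hGle _).trans ((hG.tau_stable y hyG (hνG hν)).trans (mul_le_mul_right (hGH _) _))
    · subst hTJ
      exact (hJ.apply_modelVector_sub_le hHsub _ hyJ (hνJ hν)).trans (mul_le_mul_right (hJH _) _)
    · subst hTG
      exact (hG.apply_modelVector_sub_le hHsub _ hyG (hνG hν)).trans (mul_le_mul_right (hGH _) _)
  · rw [← hTH]
    intro y hy hν
    -- The multiplicative form holds for every `u`, with common factor `1 + max ξJ ξG * ΓH (x - y)`
    -- for both summands.
    refine iSup₂_le fun u _ => sub_div_le_of_le_one_add_mul ?_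
    have hyJ := hTHJ hy
    have hyG := hTHG hy
    have hc : max ξJ ξG * ΓH (x - y) ≠ ⊤ := ENNReal.mul_ne_top
      (max_lt hJ.xi_ne_top.lt_top hG.xi_ne_top.lt_top).ne (hfin _ (Submodule.sub_mem _ hxH hy))
    have hcJ : ξJ * ΓJ (x - y) ≤ max ξJ ξG * ΓH (x - y) :=
      mul_le_mul' (le_max_left _ _) (hJH _)
    have hcG : ξG * ΓG (x - y) ≤ max ξJ ξG * ΓH (x - y) :=
      mul_le_mul' (le_max_right _ _) (hGH _)
    have heq : ∀ z, subdiffGauge H (fH z) z =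
        extGauge ({v | fJ z + v ∈ subdiff J z} + {v | fG z + v ∈ subdiff G z}) := fun z => by
      rw [hH, hfH]; exact subdiffGauge_add_eq hJ.convex hG.convex _ _ z
    rw [heq, heq]
    exact extGauge_add_set_le (convex_translated_subdiff _ _ _) (convex_translated_subdiff _ _ _)
      (zero_mem_translated_subdiff (hJ.mem_subdiff hyJ))
      (zero_mem_translated_subdiff (hG.mem_subdiff hyG)) (by simp)
      (ENNReal.add_ne_top.2 ⟨ENNReal.one_ne_top, hc⟩)
      (fun a ha => hJ.subdiffGauge_le hyJ (hνJ hν) hcJ ha)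
      (fun b hb => hG.subdiffGauge_le hyG (hνG hν) hcG hb) u

end Sum

end PartlySmooth

theorem proposition4p2 (N : ℕ) (x : EuclideanSpace ℝ (Fin N))
    (J G H : EuclideanSpace ℝ (Fin N) → ℝ)
    (ΓJ ΓG ΓH : EuclideanSpace ℝ (Fin N) → ℝ≥0∞)
    (fJ fG fH : EuclideanSpace ℝ (Fin N) → EuclideanSpace ℝ (Fin N))
    (νJ μJ τJ ξJ νG μG τG ξG : ℝ≥0∞)
    (hJ : PSFL x ΓJ fJ νJ μJ τJ ξJ J)
    (hG : PSFL x ΓG fG νG μG τG ξG G)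
    (hH : H = fun y => J y + G y)
    (hΓH : ΓH = fun v => max (ΓJ v) (ΓG v))
    (hfH : fH = fun y => fJ y + fG y)
    (TJ TG TH SH : Submodule ℝ (EuclideanSpace ℝ (Fin N)))
    (hTJ : TJ = modelSubspace J x) (hTG : TG = modelSubspace G x)
    (hTH : TH = modelSubspace H x) (hSH : SH = normalSubspace H x) :
    (opBound TJ TH.starProjection ΓJ ΓH ≠ ⊤ ∧
      opBound TG TH.starProjection ΓG ΓH ≠ ⊤ ∧
      opBound TJ (SH ⊓ TJ).starProjection ΓJ (subdiffGauge H (fH x) x) ≠ ⊤ ∧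
      opBound TG (SH ⊓ TG).starProjection ΓG (subdiffGauge H (fH x) x) ≠ ⊤) ∧
    PSFL x ΓH fH
      (min νJ νG)
      (μJ * opBound TJ TH.starProjection ΓJ ΓH + μG * opBound TG TH.starProjection ΓG ΓH)
      (τJ + τG
        + μJ * opBound TJ (SH ⊓ TJ).starProjection ΓJ (subdiffGauge H (fH x) x)
        + μG * opBound TG (SH ⊓ TG).starProjection ΓG (subdiffGauge H (fH x) x))
      (max ξJ ξG)
      H := by
  exact hJ.add hG hH hΓH hfH hTJ hTG hTH hSH
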